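/- Let $p$ be a prime and let $S$ be a scheme. A scheme $X$ has characteristic $p$ if $p=0$ in $\mathcal O_X$; its absolute Frobenius $\Phi_X:X\to X$ is then the identity on the underlying space and $g\mapsto g^p$ on $\mathcal O_X$. A scheme is perfect if, for some prime $\ell$, it has characteristic $\ell$ and its absolute Frobenius is an isomorphism. An algebraic space over $S$ is a sheaf of sets $F$ on the big fppf site $(\mathrm{Sch}/S)_{fppf}$ whose diagonal is representable by schemes and which admits a surjective étale map $h_U\to F$ from an $S$-scheme $U$. It is said to have characteristic $p$ if it is nonempty and admits such a map with $U$ of characteristic $p$, and to be perfect if it admits such a map with $U$ perfect. Let $F$ be an algebraic space over $S$ of characteristic $p$. Since the absolute Frobenius of an $S$-scheme need not be a morphism over $S$, regard $F$ as a functor $F^{\mathrm{abs}}$ on all schemes, whose $T$-points are the pairs $(q,x)$ with $q:T\to S$ a morphism and $x\in F(T,q)$; for $F=h_U$ this is the functor of points $\mathrm{Hom}(-,U)$. A surjective étale map $f:h_U\to F$ with $U$ of characteristic $p$ gives $f^{\mathrm{abs}}:\mathrm{Hom}(-,U)\to F^{\mathrm{abs}}$, and an algebraic Frobenius morphism of $F$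 with respect to $f$ is a morphism $\Psi:F^{\mathrm{abs}}\to F^{\mathrm{abs}}$ with $\Psi\circ f^{\mathrm{abs}}=f^{\mathrm{abs}}\circ h(\Phi_U)$. Theorem. (1) Let $f:h_U\to F$ be a surjective étale map from an $S$-scheme $U$ of characteristic $p$. There is exactly one algebraic Frobenius morphism $\Psi_F^U$ of $F$ with respect to $f$, and $\Psi_F^U$ is an isomorphism if and only if the absolute Frobenius $\Phi_U:U\to U$ is an isomorphism. If moreover $\Phi_U$ is a morphism over $S$, then there is exactly one morphism $\psi:F\to F$ over $S$ with $\psi\circ f=f\circ h(\Phi_U)$; it induces $\Psi_F^U$ on $F^{\mathrm{abs}}$, and $\psi$ is an isomorphism if and only if $\Phi_U$ is. (2) $F$ is perfect if and only if one of the algebraic Frobenius morphisms of $F$, with respect to some surjective étale map $h_U\to F$ with $U$ of characteristic $p$, is an isomorphism. -/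

import Mathlib

open CategoryTheory AlgebraicGeometry Opposite

universe u

noncomputable section

namespace AlgSp

/-! ### Schemes of characteristic `p` and the absolute Frobenius -/

/-- `X` has characteristic `p`: the section `p` of the structure sheaf is zero. -/
def SchemeHasChar (p : ℕ) (X : Scheme.{u}) : Prop :=
  ∀ V : X.Opens, (p : Γ(X, V)) = 0

theorem add_pow_of_natCast_eq_zero {R : Type*} [CommRing R] {p : ℕ} (hp : p.Prime)
    (h : (p : R) = 0) (x y : R) : (x + y) ^ p = x ^ p + y ^ p := by
  rcases subsingleton_or_nontrivial R with _ | _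
  · exact Subsingleton.elim _ _
  · have : CharP R p := (CharP.charP_iff_prime_eq_zero hp).2 h
    have : Fact p.Prime := ⟨hp⟩
    exact add_pow_char x y p

/-- The ring endomorphism `g ↦ g ^ p` of a commutative ring in which `p = 0`
(the zero ring is allowed). -/
def frob {R : Type*} [CommRing R] {p : ℕ} (hp : p.Prime) (h : (p : R) = 0) : R →+* R where
  toFun x := x ^ p
  map_one' := one_pow p
  map_mul' x y := mul_pow x y p
  map_zero' := zero_pow hp.ne_zero
  map_add' := add_pow_of_natCast_eq_zero hp h

/-- The absolute Frobenius as a morphism of ringed spaces: the identity on the underlying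
topological space and `g ↦ g ^ p` on sections. -/
def absFrobPresheafed {p : ℕ} (hp : p.Prime) (X : Scheme.{u}) (h : SchemeHasChar p X) :
    X.toPresheafedSpace.Hom X.toPresheafedSpace where
  base := 𝟙 _
  c :=
    { app := fun V => CommRingCat.ofHom (frob hp (h V.unop))
      naturality := by
        intro V W i
        ext x
        exact (map_pow (X.presheaf.map i).hom x p).symm }

theorem absFrob_stalkMap {p : ℕ} (hp : p.Prime) (X : Scheme.{u}) (h : SchemeHasChar p X)
    (x : X) (s : X.presheaf.stalk x) :
    ((absFrobPresheafed hp X h).stalkMap x).hom s = s ^ p := by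
  obtain ⟨V, hV, t, rfl⟩ := X.presheaf.exists_germ_eq s
  exact (PresheafedSpace.stalkMap_germ_apply (absFrobPresheafed hp X h) V x hV t).trans
    (map_pow (X.presheaf.germ V x hV).hom t p)

/-- The absolute Frobenius morphism `Φ_X : X ⟶ X` of a scheme of characteristic `p`. -/
def absFrob {p : ℕ} (hp : p.Prime) (X : Scheme.{u}) (h : SchemeHasChar p X) : X ⟶ X :=
  Scheme.Hom.mk
    { toHom := absFrobPresheafed hp X h
      prop := by
        intro x
        refine ⟨fun s hs => ?_⟩
        exact (isUnit_pow_iff hp.ne_zero).1 (absFrob_stalkMap hp X h x s ▸ hs) }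

/-- A scheme is perfect if it has characteristic `p` for some prime `p` and its absolute
Frobenius morphism is an isomorphism. -/
def IsPerfectScheme (X : Scheme.{u}) : Prop :=
  ∃ (p : ℕ) (hp : p.Prime) (h : SchemeHasChar p X), IsIso (absFrob hp X h)

/-! ### Algebraic spaces over `S` -/

variable {S : Scheme.{u}}

/-- Surjective étale morphisms of `S`-schemes. -/
def surjectiveEtale (S : Scheme.{u}) : MorphismProperty (Over S) :=
  (@Etale ⊓ @Surjective : MorphismProperty Scheme.{u}).inverseImage (Over.forget S)

/-- A map `f : h_U ⟶ F` of presheaves on `Sch/S` is surjective étale: it is representable (by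
schemes) and each of its base changes to a scheme is a surjective étale morphism of schemes. -/
def IsSurjectiveEtale {U : Over S} {F : (Over S)ᵒᵖ ⥤ Type u} (f : yoneda.obj U ⟶ F) : Prop :=
  (surjectiveEtale S).presheaf f

/-- An algebraic space over `S`: a sheaf of sets on the big fppf site of `S` whose diagonal is
representable and which admits a surjective étale map from a scheme over `S`. -/
structure AlgebraicSpace (S : Scheme.{u}) where
  /-- the underlying sheaf -/
  sheaf : Sheaf (Scheme.fppfTopology.over S) (Type u)
  diag_representable : yoneda.relativelyRepresentable (Limits.diag sheaf.obj)
  exists_atlas : ∃ (U : Over S) (f : yoneda.obj U ⟶ sheaf.obj), IsSurjectiveEtale f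

/-- The underlying presheaf of an algebraic space. -/
abbrev AlgebraicSpace.functor (F : AlgebraicSpace S) : (Over S)ᵒᵖ ⥤ Type u := F.sheaf.obj

/-- `F` is nonempty: it has a section over some nonempty scheme. -/
def AlgebraicSpace.IsNonempty (F : AlgebraicSpace S) : Prop :=
  ∃ T : Over S, Nonempty T.left ∧ Nonempty (F.functor.obj (op T))

/-- `F` has characteristic `p`: it is nonempty and admits a surjective étale map from a scheme of
characteristic `p`. -/
def AlgebraicSpace.HasChar (p : ℕ) (F : AlgebraicSpace S) : Prop :=
  F.IsNonempty ∧
    ∃ (U : Over S) (f : yoneda.obj U ⟶ F.functor), SchemeHasChar p U.left ∧ IsSurjectiveEtale f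

/-- `F` is perfect: it admits a surjective étale map from a perfect scheme. -/
def AlgebraicSpace.IsPerfect (F : AlgebraicSpace S) : Prop :=
  ∃ (U : Over S) (f : yoneda.obj U ⟶ F.functor), IsPerfectScheme U.left ∧ IsSurjectiveEtale f

/-! ### Algebraic Frobenius morphisms

The absolute Frobenius `Φ_U` of an `S`-scheme `U` is in general not a morphism over `S`, so it acts
on `U` as a scheme and not as an `S`-scheme. Accordingly an `S`-space `F` is
regarded as an absolute space: its `T`-points are the pairs of a morphism
`q : T ⟶ S` and a section of `F` over `(T, q)`. For `F = h_U` these are the morphisms `T ⟶ U`. -/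

theorem sigma_section_ext (F : (Over S)ᵒᵖ ⥤ Type u) {T : Scheme.{u}} {q q' : T ⟶ S}
    (x : F.obj (op (Over.mk q))) (x' : F.obj (op (Over.mk q'))) (h : q' = q)
    (i : Over.mk q' ⟶ Over.mk q) (hi : i.left = 𝟙 T) (hx : x' = F.map i.op x) :
    (⟨q', x'⟩ : Σ q : T ⟶ S, F.obj (op (Over.mk q))) = ⟨q, x⟩ := by
  subst h hx
  have : i = 𝟙 _ := by ext; exact hi
  subst this
  simp

/-- The functor on all schemes underlying a functor on `S`-schemes: a `T`-point is a morphism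
`q : T ⟶ S` together with a section of `F` over `(T, q)`. -/
def absolute (F : (Over S)ᵒᵖ ⥤ Type u) : Scheme.{u}ᵒᵖ ⥤ Type u where
  obj T := Σ q : T.unop ⟶ S, F.obj (op (Over.mk q))
  map {T T'} g := TypeCat.ofHom fun x =>
    ⟨g.unop ≫ x.1, F.map (Over.homMk g.unop : Over.mk (g.unop ≫ x.1) ⟶ Over.mk x.1).op x.2⟩
  map_id T := by
    refine ConcreteCategory.hom_ext _ _ fun x => ?_
    exact sigma_section_ext F x.2 _ (Category.id_comp x.1)
      (Over.homMk (𝟙 _) : Over.mk (𝟙 _ ≫ x.1) ⟶ Over.mk x.1) rfl rfl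
  map_comp {T T' T''} g g' := by
    refine ConcreteCategory.hom_ext _ _ fun x => ?_
    let a : Over.mk (g'.unop ≫ g.unop ≫ x.1) ⟶ Over.mk (g.unop ≫ x.1) := Over.homMk g'.unop
    let b : Over.mk (g.unop ≫ x.1) ⟶ Over.mk x.1 := Over.homMk g.unop
    let c : Over.mk ((g ≫ g').unop ≫ x.1) ⟶ Over.mk x.1 := Over.homMk (g ≫ g').unop
    let i : Over.mk ((g ≫ g').unop ≫ x.1) ⟶ Over.mk (g'.unop ≫ g.unop ≫ x.1) :=
      Over.homMk (𝟙 _)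
    have hc : c = i ≫ a ≫ b := by ext; simp [a, b, c, i]
    have h : F.map c.op x.2 = F.map i.op (F.map a.op (F.map b.op x.2)) := by
      rw [hc]; simp
    exact sigma_section_ext F _ _ (Category.assoc _ _ _) i rfl h

/-- The map of absolute functors induced by a map of functors on `S`-schemes. -/
def absoluteMap {F G : (Over S)ᵒᵖ ⥤ Type u} (ψ : F ⟶ G) : absolute F ⟶ absolute G where
  app T := TypeCat.ofHom fun x => ⟨x.1, ψ.app _ x.2⟩
  naturality {T T'} g := by
    ext x
    exact congrArg (fun y => (⟨g.unop ≫ x.1, y⟩ : Σ q : T'.unop ⟶ S, G.obj (op (Over.mk q))))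
      (NatTrans.naturality_apply ψ
        (Over.homMk g.unop : Over.mk (g.unop ≫ x.1) ⟶ Over.mk x.1).op x.2)

/-- A map `f : h_U ⟶ F` of functors on `S`-schemes, regarded as a map from the functor of points of
the scheme `U` to the absolute functor of `F`: it sends `t : T ⟶ U` to the section `f (t)` over
the `S`-scheme `T ⟶ U ⟶ S`. -/
def absoluteAtlas {U : Over S} {F : (Over S)ᵒᵖ ⥤ Type u} (f : yoneda.obj U ⟶ F) :
    yoneda.obj U.left ⟶ absolute F where
  app T := TypeCat.ofHom fun t =>
    ⟨t ≫ U.hom, f.app (op (Over.mk (t ≫ U.hom))) (Over.homMk t)⟩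
  naturality {T T'} g := by
    ext t
    let b : Over.mk (g.unop ≫ t ≫ U.hom) ⟶ Over.mk (t ≫ U.hom) := Over.homMk g.unop
    let i : Over.mk ((g.unop ≫ t) ≫ U.hom) ⟶ Over.mk (g.unop ≫ t ≫ U.hom) :=
      Over.homMk (𝟙 _)
    let t' : Over.mk (t ≫ U.hom) ⟶ U := Over.homMk t
    let t'' : Over.mk ((g.unop ≫ t) ≫ U.hom) ⟶ U := Over.homMk (g.unop ≫ t)
    have ht : t'' = i ≫ b ≫ t' := by ext; simp [t', t'', b, i]
    have h : f.app _ t'' = F.map i.op (F.map b.op (f.app _ t')) := by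
      rw [← NatTrans.naturality_apply, ← NatTrans.naturality_apply, ht]
      rfl
    exact sigma_section_ext F _ _ (Category.assoc _ _ _) i rfl h

/-- `Ψ` is the algebraic Frobenius morphism of `F` with respect to `f : h_U ⟶ F`, that is,
`Ψ ∘ f = f ∘ h(Φ_U)`. -/
def IsAlgebraicFrobenius {p : ℕ} (hp : p.Prime) (F : AlgebraicSpace S) {U : Over S}
    (hU : SchemeHasChar p U.left) (f : yoneda.obj U ⟶ F.functor)
    (Ψ : absolute F.functor ⟶ absolute F.functor) : Prop :=
  absoluteAtlas f ≫ Ψ = yoneda.map (absFrob hp U.left hU) ≫ absoluteAtlas f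

end AlgSp

end

noncomputable section

namespace AlgSp

/-! A point of `F` over `T` comes from `U` after an étale surjection `T' ⟶ T`, and `p = 0` descends
along it. So every `T` carrying a point has characteristic `p`, and `x ↦ x ∘ Φ_T` (`frobeniusEnd`)
is an algebraic Frobenius for every atlas of characteristic `p`. It is the only one, since `absolute
F` is an fppf sheaf (`isSheaf_absolute`) onto which the atlas is étale-locally surjective.

The isomorphism criterion rests on `isPullback_absFrob`: Frobenius squares over étale morphisms are
cartesian. If `Φ_U` is invertible, so is the Frobenius of `U ×_F U`, whence `Ψ` is injective;
composing local lifts with `Φ_U⁻¹` makes it locally surjective. Conversely, if `Ψ` is invertible, a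
preimage of the tautological point of `U` produces an inverse of `Φ_U`.

Over `S` the same formula defines `ψ`, and the rest transfers because `absoluteMap` is faithful and
reflects isomorphisms. -/

/-! ### Characteristic and Frobenius of schemes -/

theorem schemeHasChar_of_hom {p : ℕ} {X Y : Scheme.{u}} (f : X ⟶ Y) (h : SchemeHasChar p Y) :
    SchemeHasChar p X := by
  intro V
  have h₁ := congrArg (f.appTop ≫ X.presheaf.map (homOfLE le_top : V ⟶ ⊤).op).hom (h ⊤)
  simpa only [map_natCast, map_zero] using h₁

/-- Flat local homomorphisms of local rings are faithfully flat, hence injective, so `p = 0` can be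
checked on stalks upstairs. -/
theorem schemeHasChar_of_flat_surjective {p : ℕ} {X Y : Scheme.{u}} (f : X ⟶ Y) [Flat f]
    [Surjective f] (h : SchemeHasChar p X) : SchemeHasChar p Y := by
  intro V
  refine TopCat.Presheaf.section_ext Y.sheaf V _ _ fun y hy => ?_
  obtain ⟨x, rfl⟩ := f.surjective y
  algebraize [(f.stalkMap x).hom]
  have : Module.FaithfullyFlat (Y.presheaf.stalk (f x)) (X.presheaf.stalk x) :=
    @Module.FaithfullyFlat.of_flat_of_isLocalHom _ _ _ _ _ _ _
      (Flat.stalkMap f x) (f.toLRSHom.prop x)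
  have hinj : Function.Injective (f.stalkMap x).hom := ‹RingHom.FaithfullyFlat _›.injective
  have hx : (p : X.presheaf.stalk x) = 0 := by
    simpa only [map_natCast, map_zero] using
      congrArg (X.presheaf.germ ⊤ x trivial).hom (h ⊤)
  have hy' : (p : Y.presheaf.stalk (f x)) = 0 := hinj (by rw [map_natCast, map_zero, hx])
  exact (map_natCast (Y.presheaf.germ V (f x) hy).hom p).trans
    (hy'.trans (map_zero (Y.presheaf.germ V (f x) hy).hom).symm)

theorem comp_absFrob {p : ℕ} (hp : p.Prime) {X Y : Scheme.{u}} (f : X ⟶ Y)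
    (hX : SchemeHasChar p X) (hY : SchemeHasChar p Y) :
    f ≫ absFrob hp Y hY = absFrob hp X hX ≫ f := by
  refine Scheme.Hom.ext rfl fun V => CommRingCat.hom_ext (RingHom.ext fun x => ?_)
  exact (ConcreteCategory.congr_hom (X.presheaf.map_id (op (f ⁻¹ᵁ V)))
    ((f.app V).hom (x ^ p))).trans (map_pow (f.app V).hom x p)

instance absFrob_surjective {p : ℕ} (hp : p.Prime) (X : Scheme.{u}) (hX : SchemeHasChar p X) :
    Surjective (absFrob hp X hX) :=
  ⟨fun x => ⟨x, rfl⟩⟩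

/-- The comparison map `r : X ⟶ P` is étale. The Frobenius of `P` factors through `r`, and that of
`X ×_P X` through the diagonal of `r`; Frobenius being surjective, both are surjective. Thus `r` is
a flat monomorphism, so an open immersion, and it is onto. -/
theorem isPullback_absFrob {p : ℕ} (hp : p.Prime) {X Y : Scheme.{u}} (g : X ⟶ Y) [Etale g]
    (hX : SchemeHasChar p X) (hY : SchemeHasChar p Y) :
    IsPullback (absFrob hp X hX) g g (absFrob hp Y hY) := by
  let P := Limits.pullback g (absFrob hp Y hY)
  let r : X ⟶ P := Limits.pullback.lift (absFrob hp X hX) g (comp_absFrob hp g hX hY).symm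
  have hP : SchemeHasChar p P := schemeHasChar_of_hom (Limits.pullback.fst _ _) hX
  have hr₁ : r ≫ Limits.pullback.fst _ _ = absFrob hp X hX := Limits.pullback.lift_fst _ _ _
  have hr₂ : r ≫ Limits.pullback.snd _ _ = g := Limits.pullback.lift_snd _ _ _
  have : Etale (r ≫ Limits.pullback.snd g (absFrob hp Y hY)) := by rwa [hr₂]
  have : Etale r := Etale.of_comp r (Limits.pullback.snd g (absFrob hp Y hY))
  have hs : Surjective r := by
    have h : Limits.pullback.fst g (absFrob hp Y hY) ≫ r = absFrob hp P hP := by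
      apply Limits.pullback.hom_ext
      · rw [Category.assoc, hr₁, comp_absFrob hp _ hP hX]
      · rw [Category.assoc, hr₂, Limits.pullback.condition, comp_absFrob hp _ hP hY]
    have : Surjective (Limits.pullback.fst g (absFrob hp Y hY) ≫ r) := by
      rw [h]; infer_instance
    exact Surjective.of_comp (Limits.pullback.fst g (absFrob hp Y hY)) r
  have hd : Surjective (Limits.pullback.diagonal r) := by
    have hQ : SchemeHasChar p (Limits.pullback r r) :=
      schemeHasChar_of_hom (Limits.pullback.fst _ _) hX
    -- `Φ_X` factors through `r`, so it equalizes the two projections of `X ×_P X`.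
    have h : Limits.pullback.fst r r ≫ absFrob hp X hX =
        Limits.pullback.snd r r ≫ absFrob hp X hX := by
      rw [← hr₁, Limits.pullback.condition_assoc]
    have h' : (absFrob hp _ hQ ≫ Limits.pullback.fst r r) ≫ Limits.pullback.diagonal r =
        absFrob hp _ hQ := by
      apply Limits.pullback.hom_ext
      · simp
      · rw [← comp_absFrob hp _ hQ hX, h, comp_absFrob hp _ hQ hX]
        simp
    have : Surjective ((absFrob hp _ hQ ≫ Limits.pullback.fst r r) ≫
        Limits.pullback.diagonal r) := by
      rw [h']; infer_instance
    exact Surjective.of_comp (absFrob hp _ hQ ≫ Limits.pullback.fst r r) _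
  have hm : Mono r := by
    rw [← Limits.pullback.isIso_diagonal_iff, isIso_iff_isOpenImmersion_and_surjective]
    exact ⟨inferInstance, hd⟩
  have : IsOpenImmersion r := IsOpenImmersion.of_flat_of_mono r
  have : IsIso r := (isIso_iff_isOpenImmersion_and_surjective r).2 ⟨this, hs⟩
  exact IsPullback.of_iso_pullback ⟨(comp_absFrob hp g hX hY).symm⟩ (asIso r) hr₁ hr₂

/-! ### Points of the absolute functor -/

variable {S : Scheme.{u}}

/-- The section of `absolute F` over the scheme `T.left` given by a section of `F` over `T`. -/
def absoluteSection {F : (Over S)ᵒᵖ ⥤ Type u} {T : Over S} (x : F.obj (op T)) :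
    (absolute F).obj (op T.left) :=
  (⟨T.hom, x⟩ : Σ q : T.left ⟶ S, F.obj (op (Over.mk q)))

theorem absoluteSection_injective {F : (Over S)ᵒᵖ ⥤ Type u} {T : Over S} :
    Function.Injective (absoluteSection : F.obj (op T) → (absolute F).obj (op T.left)) :=
  fun _ _ h => eq_of_heq (Sigma.mk.inj h).2

theorem exists_absoluteSection_eq {F : (Over S)ᵒᵖ ⥤ Type u} {T : Scheme.{u}}
    (x : (absolute F).obj (op T)) :
    ∃ (q : T ⟶ S) (y : F.obj (op (Over.mk q))), absoluteSection y = x :=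
  ⟨x.1, x.2, rfl⟩

/-- The structure maps `k.left ≫ T.hom` and `Y.hom` are only propositionally equal; the
identity-on-schemes morphism `i` transports between them. -/
theorem map_absoluteSection {F : (Over S)ᵒᵖ ⥤ Type u} {Y T : Over S} (k : Y ⟶ T)
    (x : F.obj (op T)) :
    (absolute F).map k.left.op (absoluteSection x) = absoluteSection (F.map k.op x) := by
  let i : Over.mk (k.left ≫ T.hom) ⟶ Over.mk Y.hom := Over.homMk (𝟙 _)
  refine sigma_section_ext F (F.map k.op x) _ (Over.w k) i rfl ?_
  refine Eq.trans ?_ (Functor.map_comp_apply F k.op i.op x)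
  refine congrArg (fun a : Over.mk (k.left ≫ T.hom) ⟶ T => F.map a.op x) ?_
  ext
  simp [i]

theorem absoluteAtlas_left {U : Over S} {F : (Over S)ᵒᵖ ⥤ Type u} (f : yoneda.obj U ⟶ F)
    {T : Over S} (t : T ⟶ U) :
    (absoluteAtlas f).app (op T.left) t.left = absoluteSection (f.app (op T) t) := by
  let i : Over.mk (t.left ≫ U.hom) ⟶ Over.mk T.hom := Over.homMk (𝟙 _)
  refine sigma_section_ext F (f.app (op T) t) _ (Over.w t) i rfl ?_
  refine Eq.trans ?_ (NatTrans.naturality_apply f i.op t)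
  refine congrArg (fun a : Over.mk (t.left ≫ U.hom) ⟶ U => f.app _ a) ?_
  ext
  simp [i]

theorem yoneda_map_comp_eq_iff {C : Type*} [Category* C] {F : Cᵒᵖ ⥤ Type _} {Z U V : C}
    (f : yoneda.obj U ⟶ F) (g : yoneda.obj V ⟶ F) (a : Z ⟶ U) (b : Z ⟶ V) :
    yoneda.map a ≫ f = yoneda.map b ≫ g ↔ f.app (op Z) a = g.app (op Z) b := by
  rw [← yonedaEquiv.apply_eq_iff_eq]
  simp [yonedaEquiv_apply]

/-- Over a point `x : T ⟶ F`, the fibre product `T ×_F U`, as an absolute scheme. -/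
theorem exists_fibreProduct {U : Over S} {F : (Over S)ᵒᵖ ⥤ Type u} {f : yoneda.obj U ⟶ F}
    (hf : IsSurjectiveEtale f) {T : Scheme.{u}} (x : (absolute F).obj (op T)) :
    ∃ (T' : Scheme.{u}) (g : T' ⟶ T) (v : T' ⟶ U.left), Etale g ∧ Surjective g ∧
      (absolute F).map g.op x = (absoluteAtlas f).app (op T') v ∧
      ∀ {Z : Scheme.{u}} (a : Z ⟶ T) (b : Z ⟶ U.left),
        (absolute F).map a.op x = (absoluteAtlas f).app (op Z) b →
          ∃ c : Z ⟶ T', c ≫ g = a ∧ c ≫ v = b := by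
  obtain ⟨q, y, rfl⟩ := exists_absoluteSection_eq x
  let γ : yoneda.obj (Over.mk q) ⟶ F := yonedaEquiv.symm y
  have hγ : ∀ {Z : Over S} (a : Z ⟶ Over.mk q), γ.app (op Z) a = F.map a.op y := fun a => rfl
  obtain ⟨he, hs⟩ := hf.property_snd γ
  refine ⟨(hf.rep.pullback γ).left, (hf.rep.snd γ).left, (hf.rep.fst' γ).left, he, hs, ?_, ?_⟩
  · rw [absoluteAtlas_left]
    refine (map_absoluteSection (hf.rep.snd γ) y).trans (congrArg absoluteSection ?_)
    refine ((yoneda_map_comp_eq_iff f γ _ _).1 ?_).symm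
    rw [hf.rep.map_fst', hf.rep.w]
  · intro Z a b hab
    have hw : b ≫ U.hom = a ≫ q := (congrArg Sigma.fst hab).symm
    let a' : Over.mk (a ≫ q) ⟶ Over.mk q := Over.homMk a
    let b' : Over.mk (a ≫ q) ⟶ U := Over.homMk b hw
    have h : f.app _ b' = γ.app _ a' := by
      refine (absoluteSection_injective ?_).symm
      exact (map_absoluteSection a' y).symm.trans (hab.trans (absoluteAtlas_left f b'))
    have h' := (yoneda_map_comp_eq_iff f γ b' a').2 h
    exact ⟨(hf.rep.lift' b' a' h').left,
      congrArg CommaMorphism.left (hf.rep.lift'_snd b' a' h'),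
      congrArg CommaMorphism.left (hf.rep.lift'_fst b' a' h')⟩

theorem exists_absoluteSection_eq_of_fst_eq {F : (Over S)ᵒᵖ ⥤ Type u} {T : Over S}
    (x : (absolute F).obj (op T.left)) (h : x.1 = T.hom) :
    ∃ y : F.obj (op T), absoluteSection y = x := by
  obtain ⟨q, y⟩ := x
  dsimp only at h
  subst h
  exact ⟨y, rfl⟩

/-! ### Sheaf property and descent -/

/-- The absolute functor of a sheaf on `Sch/S` is a sheaf on `Sch`. -/
theorem isSheaf_absolute (F : Sheaf (Scheme.fppfTopology.over S) (Type u)) :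
    Presieve.IsSheaf Scheme.fppfTopology (absolute F.obj) := by
  intro T R hR x hx
  -- The structure morphisms to `S` glue first, because `h_S` is a sheaf; the sections then glue
  -- over the resulting `q`.
  have hS : Presieve.IsSheafFor (yoneda.obj S) R.arrows :=
    GrothendieckTopology.Subcanonical.isSheaf_of_isRepresentable (J := Scheme.fppfTopology)
      (yoneda.obj S) R hR
  let xq : Presieve.FamilyOfElements (yoneda.obj S) R.arrows := fun Z g hg => (x g hg).1
  have hxq : xq.Compatible := fun Y₁ Y₂ Z g₁ g₂ f₁ f₂ h₁ h₂ w =>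
    congrArg Sigma.fst (hx g₁ g₂ h₁ h₂ w)
  let q : T ⟶ S := hS.amalgamate xq hxq
  have hq : ∀ {Z : Scheme.{u}} (g : Z ⟶ T) (hg : R g), g ≫ q = (x g hg).1 :=
    fun g hg => hS.valid_glue hxq g hg
  have hF : Presieve.IsSheafFor F.obj ((Sieve.overEquiv (Over.mk q)).symm R).arrows :=
    (isSheaf_iff_isSheaf_of_type _ _).1 F.property _
      (GrothendieckTopology.overEquiv_symm_mem_over _ _ _ hR)
  have hex : ∀ ⦃Z : Over S⦄ (k : Z ⟶ Over.mk q) (hk : R k.left),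
      ∃ y : F.obj.obj (op Z), absoluteSection y = x k.left hk := fun Z k hk =>
    exists_absoluteSection_eq_of_fst_eq _ ((hq k.left hk).symm.trans (Over.w k))
  choose y hy using hex
  let y' : Presieve.FamilyOfElements F.obj ((Sieve.overEquiv (Over.mk q)).symm R).arrows :=
    fun Z k hk => y k hk
  have hy' : y'.Compatible := by
    intro Y₁ Y₂ Z g₁ g₂ f₁ f₂ h₁ h₂ w
    apply absoluteSection_injective
    rw [← map_absoluteSection, ← map_absoluteSection]
    refine (congrArg _ (hy f₁ h₁)).trans (Eq.trans ?_ (congrArg _ (hy f₂ h₂)).symm)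
    exact hx g₁.left g₂.left h₁ h₂ (congrArg CommaMorphism.left w)
  refine ⟨absoluteSection (T := Over.mk q) (hF.amalgamate y' hy'), ?_, ?_⟩
  · intro Z g hg
    let k : Over.mk (g ≫ q) ⟶ Over.mk q := Over.homMk g
    refine (map_absoluteSection k _).trans (Eq.trans ?_ (hy k hg))
    exact congrArg absoluteSection (hF.valid_glue hy' k hg)
  · intro t ht
    have htq : t.1 = q := hS.isSeparatedFor.ext fun Z g hg =>
      (congrArg Sigma.fst (ht g hg)).trans (hq g hg).symm
    obtain ⟨z, rfl⟩ := exists_absoluteSection_eq_of_fst_eq (T := Over.mk q) t htq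
    refine congrArg absoluteSection (hF.isSeparatedFor.ext fun Z k hk => ?_)
    apply absoluteSection_injective
    rw [hF.valid_glue hy' k hk]
    exact (map_absoluteSection k z).symm.trans ((ht k.left hk).trans (hy k hk).symm)

theorem generate_singleton_mem_fppfTopology {T' T : Scheme.{u}} (g : T' ⟶ T) [Etale g]
    [Surjective g] : Sieve.generate (Presieve.singleton g) ∈ Scheme.fppfTopology T :=
  Precoverage.generate_mem_toGrothendieck g.singleton_mem_fppfPrecoverage

theorem map_injective_of_isSheaf {P : Scheme.{u}ᵒᵖ ⥤ Type u}
    (hP : Presieve.IsSheaf Scheme.fppfTopology P) {T' T : Scheme.{u}} (g : T' ⟶ T) [Etale g]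
    [Surjective g] : Function.Injective (P.map g.op) := by
  intro x y h
  refine (hP _ (generate_singleton_mem_fppfTopology g)).isSeparatedFor.ext ?_
  rintro Z _ ⟨W, a, _, ⟨⟩, rfl⟩
  simp [h]

/-- A morphism of sheaves which is injective on sections and surjective locally for étale
surjections is an isomorphism. -/
theorem isIso_of_injective_of_locally_surjective {P Q : Scheme.{u}ᵒᵖ ⥤ Type u}
    (hP : Presieve.IsSheaf Scheme.fppfTopology P) (hQ : Presieve.IsSheaf Scheme.fppfTopology Q)
    (φ : P ⟶ Q) (hinj : ∀ T, Function.Injective (φ.app (op T)))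
    (hsurj : ∀ (T : Scheme.{u}) (y : Q.obj (op T)), ∃ (T' : Scheme.{u}) (g : T' ⟶ T),
      Etale g ∧ Surjective g ∧ ∃ x, φ.app (op T') x = Q.map g.op y) : IsIso φ := by
  let P' : Sheaf Scheme.fppfTopology (Type u) := ⟨P, (isSheaf_iff_isSheaf_of_type _ _).2 hP⟩
  let Q' : Sheaf Scheme.fppfTopology (Type u) := ⟨Q, (isSheaf_iff_isSheaf_of_type _ _).2 hQ⟩
  let φ' : P' ⟶ Q' := ⟨φ⟩
  have h₁ : Sheaf.IsLocallyInjective φ' :=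
    Presheaf.isLocallyInjective_of_injective _ φ fun T => hinj T.unop
  have h₂ : Sheaf.IsLocallySurjective φ' := by
    refine ⟨fun {T} y => ?_⟩
    obtain ⟨T', g, _, _, x, hx⟩ := hsurj T y
    refine Scheme.fppfTopology.superset_covering ?_ (generate_singleton_mem_fppfTopology g)
    rw [Sieve.generate_le_iff]
    rintro _ _ ⟨⟩
    exact ⟨x, hx⟩
  have : IsIso φ' := (Sheaf.isLocallyBijective_iff_isIso φ').1 ⟨h₁, h₂⟩
  exact inferInstanceAs (IsIso ((sheafToPresheaf _ _).map φ'))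

/-! ### The algebraic Frobenius and its invertibility -/

/-- The endomorphism `x ↦ x ∘ Φ_T` of a functor all of whose points are defined over schemes of
characteristic `p`. -/
def frobeniusEnd {p : ℕ} (hp : p.Prime) (G : Scheme.{u}ᵒᵖ ⥤ Type u)
    (h : ∀ {T : Scheme.{u}}, G.obj (op T) → SchemeHasChar p T) : G ⟶ G where
  app T := TypeCat.ofHom fun x => G.map (absFrob hp T.unop (h x)).op x
  naturality T T' g := by
    ext x
    change G.map (absFrob hp T'.unop _).op (G.map g x) =
      G.map g (G.map (absFrob hp T.unop (h x)).op x)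
    rw [← Functor.map_comp_apply, ← Functor.map_comp_apply]
    exact congrArg (fun a : T'.unop ⟶ T.unop => G.map a.op x)
      (comp_absFrob hp g.unop (h (G.map g x)) (h x)).symm

theorem absoluteAtlas_comp {U : Over S} {F : (Over S)ᵒᵖ ⥤ Type u} (f : yoneda.obj U ⟶ F)
    {Z T : Scheme.{u}} (a : Z ⟶ T) (t : T ⟶ U.left) :
    (absoluteAtlas f).app (op Z) (a ≫ t) =
      (absolute F).map a.op ((absoluteAtlas f).app (op T) t) :=
  NatTrans.naturality_apply (absoluteAtlas f) a.op t

theorem schemeHasChar_of_point {p : ℕ} {F : AlgebraicSpace S} {U : Over S}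
    (hU : SchemeHasChar p U.left) {f : yoneda.obj U ⟶ F.functor} (hf : IsSurjectiveEtale f)
    {T : Scheme.{u}} (x : (absolute F.functor).obj (op T)) : SchemeHasChar p T := by
  obtain ⟨T', g, v, _, _, -⟩ := exists_fibreProduct hf x
  exact schemeHasChar_of_flat_surjective g (schemeHasChar_of_hom v hU)

section Frobenius

variable {p : ℕ} (hp : p.Prime) {F : AlgebraicSpace S} {U : Over S}
  (hU : SchemeHasChar p U.left) {f : yoneda.obj U ⟶ F.functor}

theorem IsAlgebraicFrobenius.app_atlas {Ψ : absolute F.functor ⟶ absolute F.functor}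
    (h : IsAlgebraicFrobenius hp F hU f Ψ) {T : Scheme.{u}} (t : T ⟶ U.left) :
    Ψ.app (op T) ((absoluteAtlas f).app (op T) t) =
      (absoluteAtlas f).app (op T) (t ≫ absFrob hp U.left hU) :=
  ConcreteCategory.congr_hom (NatTrans.congr_app h (op T)) t

theorem isAlgebraicFrobenius_frobeniusEnd (hf : IsSurjectiveEtale f) :
    IsAlgebraicFrobenius hp F hU f
      (frobeniusEnd hp (absolute F.functor) (schemeHasChar_of_point hU hf)) := by
  ext T t
  refine (absoluteAtlas_comp f (absFrob hp T.unop _) t).symm.trans ?_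
  exact congrArg ((absoluteAtlas f).app T) (comp_absFrob hp t _ hU).symm

theorem absolute_hom_ext (hf : IsSurjectiveEtale f) {G : Scheme.{u}ᵒᵖ ⥤ Type u}
    (hG : Presieve.IsSheaf Scheme.fppfTopology G) {α β : absolute F.functor ⟶ G}
    (h : absoluteAtlas f ≫ α = absoluteAtlas f ≫ β) : α = β := by
  ext T x
  obtain ⟨T', g, v, _, _, hv, -⟩ := exists_fibreProduct hf (T := T.unop) x
  apply map_injective_of_isSheaf hG g
  refine (NatTrans.naturality_apply α g.op x).symm.trans
    (Eq.trans ?_ (NatTrans.naturality_apply β g.op x))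
  rw [hv]
  exact ConcreteCategory.congr_hom (NatTrans.congr_app h (op T')) v

theorem IsAlgebraicFrobenius.eq_frobeniusEnd (hf : IsSurjectiveEtale f)
    {Ψ : absolute F.functor ⟶ absolute F.functor} (h : IsAlgebraicFrobenius hp F hU f Ψ) :
    Ψ = frobeniusEnd hp (absolute F.functor) (schemeHasChar_of_point hU hf) :=
  absolute_hom_ext hf (isSheaf_absolute F.sheaf)
    (h.trans (isAlgebraicFrobenius_frobeniusEnd hp hU hf).symm)

/-- With `x ∘ Φ_U` the tautological point, the pair `(Φ_U, 𝟙)` gives `σ : U ⟶ T'`, where `T'` is the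
fibre product of `x` and `f`. The cartesian Frobenius square of `T' ⟶ U` yields `τ` with `Φ_T' ∘ τ =
σ`, and `v ∘ τ` is a right inverse of `Φ_U`; it commutes with `Φ_U`, so it is two-sided. -/
theorem isIso_absFrob_of_isIso (hf : IsSurjectiveEtale f)
    {Ψ : absolute F.functor ⟶ absolute F.functor} (h : IsAlgebraicFrobenius hp F hU f Ψ)
    [IsIso Ψ] : IsIso (absFrob hp U.left hU) := by
  have hb := (isIso_iff_bijective (Ψ.app (op U.left))).1 inferInstance
  obtain ⟨x, hx⟩ := hb.2 ((absoluteAtlas f).app (op U.left) (𝟙 _))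
  replace hx : (absolute F.functor).map (absFrob hp U.left hU).op x =
      (absoluteAtlas f).app (op U.left) (𝟙 _) := by
    rw [h.eq_frobeniusEnd hp hU hf] at hx
    exact hx
  obtain ⟨T', g, v, _, _, -, hlift⟩ := exists_fibreProduct hf x
  obtain ⟨σ, hσg, hσv⟩ := hlift _ _ hx
  have hT' : SchemeHasChar p T' := schemeHasChar_of_hom g hU
  have hpb := isPullback_absFrob hp g hT' hU
  let τ : U.left ⟶ T' := hpb.lift σ (𝟙 _) (by rw [hσg, Category.id_comp])
  have hτ : (τ ≫ v) ≫ absFrob hp U.left hU = 𝟙 _ := by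
    rw [Category.assoc, comp_absFrob hp v hT' hU, hpb.lift_fst_assoc, hσv]
  exact ⟨τ ≫ v, by rw [← comp_absFrob hp (τ ≫ v) hU hU, hτ], hτ⟩

/-- The Frobenius twists of `u` and `v` define a point of `R = U ×_F U`. As `R` is étale over `U`,
its Frobenius is invertible, and untwisting the point shows that `(u, v)` itself factors through
`R`. -/
theorem absoluteAtlas_eq_of_comp_absFrob_eq (hf : IsSurjectiveEtale f)
    [IsIso (absFrob hp U.left hU)] {T : Scheme.{u}} {u v : T ⟶ U.left}
    (huv : (absoluteAtlas f).app (op T) (u ≫ absFrob hp U.left hU) =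
      (absoluteAtlas f).app (op T) (v ≫ absFrob hp U.left hU)) :
    (absoluteAtlas f).app (op T) u = (absoluteAtlas f).app (op T) v := by
  have hmap : ∀ {Z : Scheme.{u}} (a : Z ⟶ U.left),
      (absolute F.functor).map a.op ((absoluteAtlas f).app (op U.left) (𝟙 U.left)) =
        (absoluteAtlas f).app (op Z) a := fun a => by
    rw [← absoluteAtlas_comp, Category.comp_id]
  obtain ⟨R, p₁, p₂, _, -, hR, hlift⟩ :=
    exists_fibreProduct hf ((absoluteAtlas f).app (op U.left) (𝟙 U.left))
  rw [hmap] at hR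
  obtain ⟨r, hr₁, hr₂⟩ := hlift (u ≫ absFrob hp U.left hU) (v ≫ absFrob hp U.left hU)
    ((hmap _).trans huv)
  have hRp : SchemeHasChar p R := schemeHasChar_of_hom p₁ hU
  have : IsIso (absFrob hp R hRp) := (isPullback_absFrob hp p₁ hRp hU).isIso_fst_of_isIso
  have hcancel : ∀ (w : T ⟶ U.left) (q : R ⟶ U.left), r ≫ q = w ≫ absFrob hp U.left hU →
      (r ≫ inv (absFrob hp R hRp)) ≫ q = w := fun w q hw => by
    rw [← cancel_mono (absFrob hp U.left hU), Category.assoc, Category.assoc,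
      comp_absFrob hp q hRp hU, IsIso.inv_hom_id_assoc, hw]
  rw [← hcancel u p₁ hr₁, ← hcancel v p₂ hr₂, absoluteAtlas_comp, hR, ← absoluteAtlas_comp]

theorem isIso_of_isIso_absFrob (hf : IsSurjectiveEtale f)
    {Ψ : absolute F.functor ⟶ absolute F.functor} (h : IsAlgebraicFrobenius hp F hU f Ψ)
    [IsIso (absFrob hp U.left hU)] : IsIso Ψ := by
  have hF := isSheaf_absolute F.sheaf
  refine isIso_of_injective_of_locally_surjective hF hF Ψ ?_ ?_
  · intro T x y hxy
    -- Two successive covers make both `x` and `y` come from `U`.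
    obtain ⟨T₁, g₁, u, _, _, hu, -⟩ := exists_fibreProduct hf x
    obtain ⟨T₂, g₂, v, _, _, hv, -⟩ :=
      exists_fibreProduct hf ((absolute F.functor).map g₁.op y)
    apply map_injective_of_isSheaf hF g₁
    apply map_injective_of_isSheaf hF g₂
    rw [hv, hu, ← absoluteAtlas_comp]
    apply absoluteAtlas_eq_of_comp_absFrob_eq hp hU hf
    rw [← h.app_atlas, ← h.app_atlas, ← hv, absoluteAtlas_comp, ← hu,
      NatTrans.naturality_apply, NatTrans.naturality_apply, NatTrans.naturality_apply,
      NatTrans.naturality_apply, hxy]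
  · intro T y
    obtain ⟨T', g, u, hg, hg', hu, -⟩ := exists_fibreProduct hf y
    refine ⟨T', g, hg, hg', (absoluteAtlas f).app (op T') (u ≫ inv (absFrob hp U.left hU)), ?_⟩
    rw [h.app_atlas, hu, Category.assoc, IsIso.inv_hom_id, Category.comp_id]

theorem isIso_iff_isIso_absFrob (hf : IsSurjectiveEtale f)
    {Ψ : absolute F.functor ⟶ absolute F.functor} (h : IsAlgebraicFrobenius hp F hU f Ψ) :
    IsIso Ψ ↔ IsIso (absFrob hp U.left hU) :=
  ⟨fun _ => isIso_absFrob_of_isIso hp hU hf h, fun _ => isIso_of_isIso_absFrob hp hU hf h⟩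

end Frobenius

/-! ### Morphisms over `S`, and comparison of primes -/

theorem absoluteMap_injective {F G : (Over S)ᵒᵖ ⥤ Type u} {ψ ψ' : F ⟶ G}
    (h : absoluteMap ψ = absoluteMap ψ') : ψ = ψ' := by
  ext T x
  exact absoluteSection_injective
    (ConcreteCategory.congr_hom (NatTrans.congr_app h (op T.unop.left)) (absoluteSection x))

theorem isIso_absoluteMap_iff {F G : (Over S)ᵒᵖ ⥤ Type u} (ψ : F ⟶ G) :
    IsIso (absoluteMap ψ) ↔ IsIso ψ := by
  refine ⟨fun _ => ?_, fun _ => ⟨absoluteMap (inv ψ), ?_, ?_⟩⟩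
  · rw [NatTrans.isIso_iff_isIso_app]
    intro T
    have hb := (isIso_iff_bijective ((absoluteMap ψ).app (op T.unop.left))).1 inferInstance
    rw [isIso_iff_bijective]
    refine ⟨fun x y hxy => ?_, fun y => ?_⟩
    · exact absoluteSection_injective (hb.1 (congrArg absoluteSection hxy))
    · obtain ⟨x, hx⟩ := hb.2 (absoluteSection y)
      obtain ⟨z, rfl⟩ := exists_absoluteSection_eq_of_fst_eq x (congrArg Sigma.fst hx)
      exact ⟨z, absoluteSection_injective hx⟩
  · change absoluteMap (ψ ≫ inv ψ) = absoluteMap (𝟙 F)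
    rw [IsIso.hom_inv_id]
  · change absoluteMap (inv ψ ≫ ψ) = absoluteMap (𝟙 G)
    rw [IsIso.inv_hom_id]

theorem absoluteAtlas_yoneda_map_comp {U V : Over S} {F : (Over S)ᵒᵖ ⥤ Type u}
    (f : yoneda.obj V ⟶ F) (φ : U ⟶ V) :
    absoluteAtlas (yoneda.map φ ≫ f) = yoneda.map φ.left ≫ absoluteAtlas f := by
  ext T t
  let t' : Over.mk (t ≫ U.hom) ⟶ U := Over.homMk t
  exact (absoluteAtlas_left (yoneda.map φ ≫ f) t').trans (absoluteAtlas_left f (t' ≫ φ)).symm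

/-- By Bézout, `1 = 0` in the global sections. The empty scheme has every characteristic, so
nonemptiness cannot be dropped. -/
theorem not_nonempty_of_hasChar_of_ne {p q : ℕ} (hp : p.Prime) (hq : q.Prime) (hpq : p ≠ q)
    {X : Scheme.{u}} (hXp : SchemeHasChar p X) (hXq : SchemeHasChar q X) : ¬ Nonempty X := by
  rintro ⟨x⟩
  have h := congrArg (Int.cast : ℤ → Γ(X, ⊤)) (Nat.gcd_eq_gcd_ab p q).symm
  rw [(Nat.coprime_primes hp hq).2 hpq] at h
  push_cast [hXp ⊤, hXq ⊤] at h
  have : Nonempty (⊤ : X.Opens) := ⟨⟨x, trivial⟩⟩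
  simp at h

section Frobenius

variable {p : ℕ} (hp : p.Prime) {F : AlgebraicSpace S} {U : Over S}
  (hU : SchemeHasChar p U.left) {f : yoneda.obj U ⟶ F.functor}

theorem isAlgebraicFrobenius_absoluteMap {φ : U ⟶ U} (hφ : φ.left = absFrob hp U.left hU)
    {ψ : F.functor ⟶ F.functor} (h : f ≫ ψ = yoneda.map φ ≫ f) :
    IsAlgebraicFrobenius hp F hU f (absoluteMap ψ) := by
  have h' := congrArg absoluteAtlas h
  rw [absoluteAtlas_yoneda_map_comp, hφ] at h'
  exact h'

/-- If the absolute Frobenius of an atlas is a morphism over `S`, then so is that of every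
`S`-scheme carrying a point of the algebraic space. -/
theorem absFrob_comp_hom (hf : IsSurjectiveEtale f)
    (hS : absFrob hp U.left hU ≫ U.hom = U.hom) {T : Over S} (x : F.functor.obj (op T))
    (hT : SchemeHasChar p T.left) : absFrob hp T.left hT ≫ T.hom = T.hom := by
  obtain ⟨T', g, v, _, _, hv, -⟩ := exists_fibreProduct hf (absoluteSection x)
  have hT' : SchemeHasChar p T' := schemeHasChar_of_hom v hU
  have hgv : g ≫ T.hom = v ≫ U.hom := congrArg Sigma.fst hv
  -- The claim holds after pulling back to `T'`, and `g` is an epimorphism.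
  have := Flat.epi_of_flat_of_surjective g
  rw [← cancel_epi g, ← Category.assoc, comp_absFrob hp g hT' hT, Category.assoc, hgv,
    ← Category.assoc, ← comp_absFrob hp v hT' hU, Category.assoc, hS]

theorem exists_frobenius_over (hf : IsSurjectiveEtale f) {φ : U ⟶ U}
    (hφ : φ.left = absFrob hp U.left hU) :
    ∃ ψ : F.functor ⟶ F.functor, f ≫ ψ = yoneda.map φ ≫ f := by
  have hT : ∀ {T : Over S}, F.functor.obj (op T) → SchemeHasChar p T.left := fun x =>
    schemeHasChar_of_point hU hf (absoluteSection x)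
  have hS : absFrob hp U.left hU ≫ U.hom = U.hom := hφ ▸ Over.w φ
  let Φ : ∀ {T : Over S}, F.functor.obj (op T) → (T ⟶ T) := fun {T} x =>
    Over.homMk (absFrob hp T.left (hT x)) (absFrob_comp_hom hp hU hf hS x (hT x))
  let ψ : F.functor ⟶ F.functor :=
    { app T := TypeCat.ofHom fun x => F.functor.map (Φ x).op x
      naturality T T' k := by
        ext x
        change F.functor.map (Φ (F.functor.map k x)).op (F.functor.map k x) =
          F.functor.map k (F.functor.map (Φ x).op x)
        rw [← Functor.map_comp_apply, ← Functor.map_comp_apply]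
        refine congrArg (fun a : T'.unop ⟶ T.unop => F.functor.map a.op x) ?_
        ext1
        exact (comp_absFrob hp k.unop.left _ _).symm }
  refine ⟨ψ, ?_⟩
  ext T t
  refine (NatTrans.naturality_apply f (Φ (f.app T t)).op t).symm.trans ?_
  refine congrArg (f.app T) (Over.OverMorphism.ext ?_)
  change absFrob hp T.unop.left _ ≫ t.left = t.left ≫ φ.left
  rw [hφ, comp_absFrob]

end Frobenius

/-- The primes of a characteristic-`p` atlas and a characteristic-`q` atlas of a nonempty algebraic
space agree. -/
theorem prime_eq_of_atlas {p q : ℕ} (hp : p.Prime) (hq : q.Prime) {F : AlgebraicSpace S}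
    (hF : F.IsNonempty) {U V : Over S} (hU : SchemeHasChar p U.left) (hV : SchemeHasChar q V.left)
    {f : yoneda.obj U ⟶ F.functor} (hf : IsSurjectiveEtale f)
    {g : yoneda.obj V ⟶ F.functor} (hg : IsSurjectiveEtale g) : p = q := by
  obtain ⟨T, hT, ⟨x⟩⟩ := hF
  by_contra hpq
  exact not_nonempty_of_hasChar_of_ne hp hq hpq
    (schemeHasChar_of_point hU hf (absoluteSection x))
    (schemeHasChar_of_point hV hg (absoluteSection x)) hT

end AlgSp

end

theorem theorem4 {p : ℕ} (hp : p.Prime) (S : Scheme.{u}) (F : AlgSp.AlgebraicSpace S)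
    (hF : F.HasChar p) :
    (∀ (U : Over S) (hU : AlgSp.SchemeHasChar p U.left) (f : yoneda.obj U ⟶ F.functor),
      AlgSp.IsSurjectiveEtale f →
        (∃! Ψ : AlgSp.absolute F.functor ⟶ AlgSp.absolute F.functor,
          AlgSp.IsAlgebraicFrobenius hp F hU f Ψ) ∧
        (∀ Ψ : AlgSp.absolute F.functor ⟶ AlgSp.absolute F.functor,
          AlgSp.IsAlgebraicFrobenius hp F hU f Ψ →
            (IsIso Ψ ↔ IsIso (AlgSp.absFrob hp U.left hU))) ∧
        (∀ φ : U ⟶ U, φ.left = AlgSp.absFrob hp U.left hU →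
          (∃! ψ : F.functor ⟶ F.functor, f ≫ ψ = yoneda.map φ ≫ f) ∧
          (∀ ψ : F.functor ⟶ F.functor, f ≫ ψ = yoneda.map φ ≫ f →
            AlgSp.IsAlgebraicFrobenius hp F hU f (AlgSp.absoluteMap ψ) ∧
            (IsIso ψ ↔ IsIso (AlgSp.absFrob hp U.left hU))))) ∧
    (F.IsPerfect ↔
      ∃ (U : Over S) (hU : AlgSp.SchemeHasChar p U.left) (f : yoneda.obj U ⟶ F.functor)
        (Ψ : AlgSp.absolute F.functor ⟶ AlgSp.absolute F.functor),
        AlgSp.IsSurjectiveEtale f ∧ AlgSp.IsAlgebraicFrobenius hp F hU f Ψ ∧ IsIso Ψ) := by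
  refine ⟨fun U hU f hf => ⟨?_, fun Ψ hΨ => AlgSp.isIso_iff_isIso_absFrob hp hU hf hΨ,
    fun φ hφ => ⟨?_, fun ψ hψ => ?_⟩⟩, ?_, ?_⟩
  · exact ⟨_, AlgSp.isAlgebraicFrobenius_frobeniusEnd hp hU hf,
      fun Ψ hΨ => hΨ.eq_frobeniusEnd hp hU hf⟩
  · obtain ⟨ψ, hψ⟩ := AlgSp.exists_frobenius_over hp hU hf hφ
    refine ⟨ψ, hψ, fun ψ' hψ' => AlgSp.absoluteMap_injective ?_⟩
    rw [(AlgSp.isAlgebraicFrobenius_absoluteMap hp hU hφ hψ).eq_frobeniusEnd hp hU hf,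
      (AlgSp.isAlgebraicFrobenius_absoluteMap hp hU hφ hψ').eq_frobeniusEnd hp hU hf]
  · have h := AlgSp.isAlgebraicFrobenius_absoluteMap hp hU hφ hψ
    exact ⟨h, (AlgSp.isIso_absoluteMap_iff ψ).symm.trans
      (AlgSp.isIso_iff_isIso_absFrob hp hU hf h)⟩
  · rintro ⟨U, f, ⟨q, hq, hU, hiso⟩, hf⟩
    obtain ⟨hne, V, g, hV, hg⟩ := hF
    -- Perfectness only provides some prime `q`; a nonempty scheme carrying a point of `F` forces it
    -- to be `p`.
    obtain rfl := AlgSp.prime_eq_of_atlas hp hq hne hV hU hg hf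
    have h := AlgSp.isAlgebraicFrobenius_frobeniusEnd hp hU hf
    exact ⟨U, hU, f, _, hf, h, (AlgSp.isIso_iff_isIso_absFrob hp hU hf h).2 hiso⟩
  · rintro ⟨U, hU, f, Ψ, hf, hΨ, hiso⟩
    exact ⟨U, f, ⟨p, hp, hU, (AlgSp.isIso_iff_isIso_absFrob hp hU hf hΨ).1 hiso⟩, hf⟩
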